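/- Let $G=(V,E)$ be a finite, simple, connected undirected graph. In the concurrent cops-and-robber game with $K\ge 1$ cops, started at given positions, in each round $t=1,2,\dots$ all cops and the robber simultaneously move to a vertex of the closed neighborhood of their current vertex (an illegal move is ignored). The robber is captured if, at some time $t\ge 0$, a cop is on his vertex, or if in some round he and a cop exchange their vertices (he is then placed on the vertex he was leaving); after a capture nothing moves. Both players observe the whole history of positions and use randomized, history-dependent strategies. Let $\tilde c(G)$ be the smallest $K\ge 1$ such that, from every initial position, the cops have a strategy that captures the robber with probability one against every robber strategy. Consider one cop. Let $\widetilde Q((x,y),u,w)$ be the position that follows $(x,y)$ when the cop plays $u\in V$ and the robber plays $w\in V$, and let $r(x,y)=1$ if $x\ne y$ and $r(x,y)=0$ if $x=y$. For a real matrix $(A_{u,w})_{u,w\in V}$ let $\mathbf{Val}[A_{u,w}]$ be the mixed-strategy value of the zero-sum game in which the cop chooses $u$ to minimize and the robber chooses $w$ to maximize. For $k\in\{0,1\}$ let $\Gamma^{k}_{(x,y)}$ be the game started at $(x_0,y_0)=(x,y)$ with payoff $\mathbb E\big(\sum_{t=k}^{\infty} r(x_t,y_t)\big)$, minimized by the cop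 and maximized by the robber. (For $k=0$ the payoff is the expected capture time; for $k=1$ the initial position is not counted.) Put $$\rho_0((x,y),u,w)=r(x,y),\qquad \rho_1((x,y),u,w)=r\big(\widetilde Q((x,y),u,w)\big).$$ **Theorem.** Suppose that $\tilde c(G)=1$, and let $k\in\{0,1\}$. Then for every $(x,y)\in V^2$ the game $\Gamma^{k}_{(x,y)}$ has a finite value $\hat v_{(x,y)}$ (its $\inf\sup$ and its $\sup\inf$ over the strategies of the two players coincide), and $(\hat v_{(x,y)})_{(x,y)\in V^2}$ is the componentwise smallest nonnegative real solution $v$ of the optimality equations $$v_{(x,y)}=\mathbf{Val}\big[\rho_k((x,y),u,w)+v_{\widetilde Q((x,y),u,w)}\big]\ \text{ for } x\ne y,\qquad v_{(x,y)}=0\ \text{ for } x=y.$$ Moreover, for all real initial values $v_{(x,y)}(0)\ge 0$ with $v_{(x,x)}(0)=0$, the value iteration $$v_{(x,y)}(n+1)=\mathbf{Val}\big[\rho_k((x,y),u,w)+v_{\widetilde Q((x,y),u,w)}(n)\big]\ \text{ for } x\ne y,\qquad v_{(x,x)}(n+1)=0,$$ satisfies $\lim_{n\to\infty}v_{(x,y)}(n)=\hat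 v_{(x,y)}$ for all $(x,y)\in V^2$. -/

import Mathlib

open MeasureTheory ProbabilityTheory Filter Topology
open scoped ENNReal

namespace CCCR

noncomputable section

/-! ### Positions -/

/-- A game position: the location `cop` of the cop (or the vector of locations of all cops) and the
location `robber` of the robber. -/
@[ext]
structure Position (X V : Type*) where
  cop : X
  robber : V

/-- Positions carry the discrete σ-algebra. -/
instance {X V : Type*} : MeasurableSpace (Position X V) := ⊤

instance {X V : Type*} : DiscreteMeasurableSpace (Position X V) := ⟨fun _ => trivial⟩

instance {X V : Type*} [Finite X] [Finite V] : Finite (Position X V) :=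
  Finite.of_injective (fun s : Position X V => (s.cop, s.robber)) (by
    rintro ⟨a, b⟩ ⟨c, d⟩ h
    simpa using h)

/-! ### Randomized strategies and the law of the play -/

/-- A randomized strategy: for every time `t` and every history of positions at times `0, …, t`, a
probability distribution on the moves in `M`. -/
def Strategy (S M : Type*) : Type _ :=
  (t : ℕ) → (Finset.Iic t → S) → PMF M

section Play

variable {S A B : Type*} [MeasurableSpace S] [DiscreteMeasurableSpace S] [Finite S]

/-- The conditional law of the position at time `t + 1` given the positions at times `0, …, t`: the
two players draw their moves independently of each other from their strategies, and the transition
function `Q` gives the new position. -/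
def stepKernel (Q : S → A → B → S) (πC : Strategy S A) (πR : Strategy S B) (t : ℕ) :
    Kernel (Finset.Iic t → S) S where
  toFun h := ((πC t h).bind fun a =>
    (πR t h).map fun b => Q (h ⟨t, Finset.mem_Iic.2 le_rfl⟩) a b).toMeasure
  measurable' := Measurable.of_discrete

instance (Q : S → A → B → S) (πC : Strategy S A) (πR : Strategy S B) (t : ℕ) :
    IsMarkovKernel (stepKernel Q πC πR t) :=
  ⟨fun h => by
    change IsProbabilityMeasure (PMF.toMeasure _)
    infer_instance⟩

/-- The law of the infinite sequence of positions of the game that starts at `s₀`, when the players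
use the strategies `πC` and `πR`. -/
def playLaw (Q : S → A → B → S) (s₀ : S) (πC : Strategy S A) (πR : Strategy S B) :
    Measure (ℕ → S) :=
  Kernel.traj (X := fun _ => S) (stepKernel Q πC πR) 0 (fun _ => s₀)

end Play

/-! ### Rules of the game -/

variable {V : Type*}

open Classical in
/-- The location reached from `x` by the move `x'`: this is `x'` when `x'` is in the closed
neighborhood of `x`; otherwise the move is illegal and is ignored. -/
def moveTo (G : SimpleGraph V) (x x' : V) : V :=
  if x' = x ∨ G.Adj x x' then x' else x

open Classical in
/-- The transition function with one cop: after a capture nothing moves; if the two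
tokens exchange their places, the robber is captured en passant, at his old location. -/
def nextPos (G : SimpleGraph V) (s : Position V V) (u w : V) : Position V V :=
  if s.cop = s.robber then s
  else if moveTo G s.cop u = s.robber ∧ moveTo G s.robber w = s.cop then ⟨s.robber, s.robber⟩
  else ⟨moveTo G s.cop u, moveTo G s.robber w⟩

/-- With `K` cops, the robber is captured when some cop is at his location. -/
def Captured {K : ℕ} (s : Position (Fin K → V) V) : Prop :=
  ∃ i, s.cop i = s.robber

open Classical in
/-- The transition function with `K` cops: after a capture nothing moves; if some
cop and the robber exchange their places, the robber is captured en passant, at his old location. -/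
def nextPosK (G : SimpleGraph V) {K : ℕ} (s : Position (Fin K → V) V) (u : Fin K → V) (w : V) :
    Position (Fin K → V) V :=
  if Captured s then s
  else if ∃ i, moveTo G (s.cop i) (u i) = s.robber ∧ moveTo G s.robber w = s.cop i then
    ⟨fun i => moveTo G (s.cop i) (u i), s.robber⟩
  else ⟨fun i => moveTo G (s.cop i) (u i), moveTo G s.robber w⟩

/-! ### The concurrent cop number -/

/-- `K` cops suffice: for every initial position the cop player has a strategy that captures the
robber with probability one against every strategy of the robber. -/
def CopsSuffice [Finite V] (G : SimpleGraph V) (K : ℕ) : Prop :=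
  ∀ s₀ : Position (Fin K → V) V, ∃ πC : Strategy (Position (Fin K → V) V) (Fin K → V),
    ∀ πR : Strategy (Position (Fin K → V) V) V,
      playLaw (nextPosK G) s₀ πC πR {ω | ∃ t, Captured (ω t)} = 1

/-- The concurrent cop number: the smallest number `K ≥ 1` of cops that suffices. -/
def concurrentCopNumber [Finite V] (G : SimpleGraph V) : ℕ :=
  sInf {K | 1 ≤ K ∧ CopsSuffice G K}

/-! ### Payoff and value of the game with one cop -/

open Classical in
/-- The payment `r(x, y)`: one unit if the robber is free, and nothing otherwise. -/
def reward (s : Position V V) : ℝ :=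
  if s.cop = s.robber then 0 else 1

/-- The expected value of `∑_{t ≥ k} r(x_t, y_t)` when the game starts at `s₀`.
For `k = 0` this is the expected capture time; for `k = 1` it is the expected amount that is paid in
the rounds `1, 2, …`, so that the initial position does not contribute. -/
def payoff [Finite V] (G : SimpleGraph V) (k : ℕ) (s₀ : Position V V)
    (πC πR : Strategy (Position V V) V) : ℝ≥0∞ :=
  ∫⁻ ω, ∑' t, ENNReal.ofReal (reward (ω (k + t))) ∂(playLaw (nextPos G) s₀ πC πR)

/-- `a` is the value of the game that starts at `s₀` and has the payoff `payoff G k`, which the cop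
minimizes and the robber maximizes: the upper and the lower value both exist and equal `a`. -/
def IsGameValue [Finite V] (G : SimpleGraph V) (k : ℕ) (s₀ : Position V V) (a : ℝ≥0∞) : Prop :=
  (⨅ πC, ⨆ πR, payoff G k s₀ πC πR) = a ∧ (⨆ πR, ⨅ πC, payoff G k s₀ πC πR) = a

/-! ### Matrix games -/

/-- The value of the finite zero-sum game with payoff matrix `M` in mixed strategies, where the
minimizing player chooses `u` and the maximizing player chooses `w`. -/
def matrixValue {I J : Type*} [Fintype I] [Fintype J] (M : I → J → ℝ) : ℝ :=
  ⨆ q : stdSimplex ℝ J, ⨅ p : stdSimplex ℝ I, ∑ u, ∑ w, p.1 u * q.1 w * M u w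

open Classical in
/-- The right-hand side of the optimality equations, as an operator on real functions of the
position; `ρ s s'` is the payment for the round that leads from `s` to `s'`. -/
def shapley [Fintype V] (G : SimpleGraph V) (ρ : Position V V → Position V V → ℝ)
    (v : Position V V → ℝ) (s : Position V V) : ℝ :=
  if s.cop = s.robber then 0
  else matrixValue fun u w : V => ρ s (nextPos G s u w) + v (nextPos G s u w)

end

end CCCR

open CCCR

/-!
Let `a n` be the value of the game truncated after `n` rounds, obtained by iterating the optimality
operator from `0`. The sequence `a` is monotone. Were it unbounded, a limit point `p` of
`a n / ‖a n‖` would be a nonzero potential that vanishes after a capture and that the robber can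
keep from decreasing in mean. The expectation of `p` along the play would then stay away from `0`,
although the cop can capture the robber with probability one. Hence `a` converges to a solution `v`,
which is below every nonnegative solution. An optimal mixed action of the cop against `v` in each
round keeps the expected cost below `v`, and the robber secures `a n` for every `n`, so `v` is the
value of the game.

For the value iteration, let `c` be the stage cost. A bound `v ≤ (k + 1) • c` makes the optimality
operator map `(1 + e) • v` below `(1 + e * (k / (k + 1))) • v`, which squeezes every orbit between
`a n` and a sequence decreasing to `v`.

Not counting the initial position changes all values by `c`: the function `f` solves the second
system of equations if and only if `c + f` solves the first.
-/

namespace CCCR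

section MatrixGame

variable {I J : Type*} [Fintype I] [Fintype J]

lemma sum_mul_le_of_mem_stdSimplex {p f : I → ℝ} {b : ℝ} (hp : p ∈ stdSimplex ℝ I)
    (hf : ∀ i, f i ≤ b) : ∑ i, p i * f i ≤ b :=
  (convex_Iic b).sum_mem (fun i _ => hp.1 i) hp.2 fun i _ => hf i

lemma le_sum_mul_of_mem_stdSimplex {p f : I → ℝ} {b : ℝ} (hp : p ∈ stdSimplex ℝ I)
    (hf : ∀ i, b ≤ f i) : b ≤ ∑ i, p i * f i :=
  (convex_Ici b).sum_mem (fun i _ => hp.1 i) hp.2 fun i _ => hf i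

open Classical in
/-- The mixed extension of the matrix game `M`, as a bilinear form on all weight vectors. -/
noncomputable def mixedExtension (M : I → J → ℝ) : (I → ℝ) →ₗ[ℝ] (J → ℝ) →ₗ[ℝ] ℝ :=
  Matrix.toLinearMap₂' ℝ (Matrix.of M)

lemma mixedExtension_apply (M : I → J → ℝ) (p : I → ℝ) (q : J → ℝ) :
    mixedExtension M p q = ∑ u, ∑ w, p u * q w * M u w := by
  simp [mixedExtension, Matrix.toLinearMap₂'_apply, mul_assoc]

lemma mixedExtension_eq_sum_left (M : I → J → ℝ) (p : I → ℝ) (q : J → ℝ) :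
    mixedExtension M p q = ∑ u, p u * ∑ w, q w * M u w := by
  simp only [mixedExtension_apply, Finset.mul_sum, mul_assoc]

lemma mixedExtension_eq_sum_right (M : I → J → ℝ) (p : I → ℝ) (q : J → ℝ) :
    mixedExtension M p q = ∑ w, q w * ∑ u, p u * M u w := by
  rw [mixedExtension_apply, Finset.sum_comm]
  simp only [Finset.mul_sum, mul_left_comm, mul_assoc]

lemma bddBelow_range_mixedExtension (M : I → J → ℝ) (q : J → ℝ) :
    BddBelow (Set.range fun p : stdSimplex ℝ I => mixedExtension M p.1 q) := by
  obtain ⟨b, hb⟩ := (Set.finite_range fun u => ∑ w, q w * M u w).bddBelow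
  refine ⟨b, Set.forall_mem_range.2 fun p => ?_⟩
  rw [mixedExtension_eq_sum_left]
  exact le_sum_mul_of_mem_stdSimplex p.2 fun u => hb ⟨u, rfl⟩

lemma matrixValue_eq_iSup_iInf (M : I → J → ℝ) :
    matrixValue M = ⨆ q : stdSimplex ℝ J, ⨅ p : stdSimplex ℝ I, mixedExtension M p.1 q.1 := by
  simp only [matrixValue, mixedExtension_apply]

lemma matrixValue_smul {k : ℝ} (hk : 0 ≤ k) (M : I → J → ℝ) :
    matrixValue (k • M) = k * matrixValue M := by
  simp only [matrixValue, Real.mul_iSup_of_nonneg hk, Real.mul_iInf_of_nonneg hk, Finset.mul_sum,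
    Pi.smul_apply, smul_eq_mul, mul_left_comm k]

variable {M N : I → J → ℝ} {b : ℝ}

lemma iInf_mixedExtension_le_of_forall_sum_le {p : I → ℝ}
    (hp : p ∈ stdSimplex ℝ I) (h : ∀ w, ∑ u, p u * M u w ≤ b) (q : stdSimplex ℝ J) :
    ⨅ p : stdSimplex ℝ I, mixedExtension M p.1 q.1 ≤ b := by
  refine (ciInf_le (bddBelow_range_mixedExtension M q.1) ⟨p, hp⟩).trans ?_
  rw [mixedExtension_eq_sum_right]
  exact sum_mul_le_of_mem_stdSimplex q.2 h

lemma matrixValue_le [Nonempty J] {p : I → ℝ} (hp : p ∈ stdSimplex ℝ I)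
    (h : ∀ w, ∑ u, p u * M u w ≤ b) : matrixValue M ≤ b := by
  rw [matrixValue_eq_iSup_iInf]
  exact ciSup_le (iInf_mixedExtension_le_of_forall_sum_le hp h)

lemma le_matrixValue [Nonempty I] {q : J → ℝ} (hq : q ∈ stdSimplex ℝ J)
    (h : ∀ u, b ≤ ∑ w, q w * M u w) : b ≤ matrixValue M := by
  obtain ⟨p⟩ : Nonempty (stdSimplex ℝ I) := inferInstance
  obtain ⟨B, hB⟩ := (Set.finite_range fun w => ∑ u, p.1 u * M u w).bddAbove
  have hbdd : BddAbove (Set.range fun q : stdSimplex ℝ J =>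
      ⨅ p : stdSimplex ℝ I, mixedExtension M p.1 q.1) :=
    ⟨B, Set.forall_mem_range.2 <|
      iInf_mixedExtension_le_of_forall_sum_le p.2 fun w => hB ⟨w, rfl⟩⟩
  rw [matrixValue_eq_iSup_iInf]
  refine (le_ciInf fun p => ?_).trans (le_ciSup hbdd ⟨q, hq⟩)
  rw [mixedExtension_eq_sum_left]
  exact le_sum_mul_of_mem_stdSimplex p.2 h

variable [Nonempty I] [Nonempty J]

lemma exists_isSaddlePointOn_mixedExtension (M : I → J → ℝ) :
    ∃ p ∈ stdSimplex ℝ I, ∃ q ∈ stdSimplex ℝ J,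
      IsSaddlePointOn (stdSimplex ℝ I) (stdSimplex ℝ J) (fun p q => mixedExtension M p q) p q :=
  Sion.exists_isSaddlePointOn
    (Set.nonempty_coe_sort.1 inferInstance) (convex_stdSimplex ℝ I) (isCompact_stdSimplex ℝ I)
    (fun q _ => ((mixedExtension M).flip q).continuous_of_finiteDimensional.lowerSemicontinuous
      |>.lowerSemicontinuousOn _)
    (fun q _ => (((mixedExtension M).flip q).convexOn (convex_stdSimplex ℝ I)).quasiconvexOn)
    (convex_stdSimplex ℝ J) (Set.nonempty_coe_sort.1 inferInstance) (isCompact_stdSimplex ℝ J)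
    (fun p _ => (mixedExtension M p).continuous_of_finiteDimensional.upperSemicontinuous
      |>.upperSemicontinuousOn _)
    (fun p _ => ((mixedExtension M p).concaveOn (convex_stdSimplex ℝ J)).quasiconcaveOn)

theorem exists_optimal_mixed_actions (M : I → J → ℝ) :
    (∃ p ∈ stdSimplex ℝ I, ∀ w, ∑ u, p u * M u w ≤ matrixValue M) ∧
      ∃ q ∈ stdSimplex ℝ J, ∀ u, matrixValue M ≤ ∑ w, q w * M u w := by
  classical
  obtain ⟨p, hp, q, hq, hpq⟩ := exists_isSaddlePointOn_mixedExtension M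
  have hleft (w) : ∑ u, p u * M u w ≤ mixedExtension M p q := by
    simpa [mixedExtension_eq_sum_right, Pi.single_apply] using
      hpq p hp _ (single_mem_stdSimplex ℝ w)
  have hright (u) : mixedExtension M p q ≤ ∑ w, q w * M u w := by
    simpa [mixedExtension_eq_sum_left, Pi.single_apply] using
      hpq _ (single_mem_stdSimplex ℝ u) q hq
  exact ⟨⟨p, hp, fun w => (hleft w).trans (le_matrixValue hq hright)⟩,
    ⟨q, hq, fun u => (matrixValue_le hp hleft).trans (hright u)⟩⟩

lemma matrixValue_le_add (h : ∀ u w, M u w ≤ N u w + b) : matrixValue M ≤ matrixValue N + b := by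
  obtain ⟨p, hp, hpN⟩ := (exists_optimal_mixed_actions N).1
  refine matrixValue_le hp fun w => ?_
  calc ∑ u, p u * M u w ≤ ∑ u, p u * (N u w + b) := by gcongr with u; exacts [hp.1 u, h u w]
    _ = ∑ u, p u * N u w + b := by
        simp only [mul_add, Finset.sum_add_distrib, ← Finset.sum_mul, hp.2, one_mul]
    _ ≤ matrixValue N + b := by gcongr; exact hpN w

lemma matrixValue_mono : Monotone (matrixValue (I := I) (J := J)) := fun M N h => by
  simpa using matrixValue_le_add (b := 0) fun u w => (h u w).trans (add_zero _).ge

lemma matrixValue_const (b : ℝ) : matrixValue (fun (_ : I) (_ : J) => b) = b := by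
  obtain ⟨p, hp⟩ : Nonempty (stdSimplex ℝ I) := inferInstance
  obtain ⟨q, hq⟩ : Nonempty (stdSimplex ℝ J) := inferInstance
  exact (matrixValue_le hp fun _ => sum_mul_le_of_mem_stdSimplex hp fun _ => le_rfl).antisymm
    (le_matrixValue hq fun _ => le_sum_mul_of_mem_stdSimplex hq fun _ => le_rfl)

lemma matrixValue_const_add (b : ℝ) (M : I → J → ℝ) :
    matrixValue (fun u w => b + M u w) = b + matrixValue M := by
  refine le_antisymm ?_ (le_sub_iff_add_le'.1 ?_)
  · rw [add_comm]
    exact matrixValue_le_add fun u w => (add_comm _ _).le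
  · exact matrixValue_le_add fun u w => by simp

lemma lipschitzWith_matrixValue : LipschitzWith 1 (matrixValue (I := I) (J := J)) :=
  LipschitzWith.of_le_add fun M N => matrixValue_le_add fun u w => by
    have h := (dist_le_pi_dist (M u) (N u) w).trans (dist_le_pi_dist M N u)
    rw [Real.dist_eq] at h
    linarith [le_of_abs_le h]

end MatrixGame

section PlayLaw

variable {S A B : Type*} [MeasurableSpace S]

/-- The last entry of a history. -/
def lastPos {t : ℕ} (h : Finset.Iic t → S) : S := h ⟨t, Finset.mem_Iic.2 le_rfl⟩

variable [DiscreteMeasurableSpace S] [Finite S] (Q : S → A → B → S) (s₀ : S)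
  (πC : Strategy S A) (πR : Strategy S B)

instance : IsProbabilityMeasure (playLaw Q s₀ πC πR) := by
  unfold playLaw; infer_instance

lemma lintegral_playLaw_zero (f : S → ℝ≥0∞) : ∫⁻ ω, f (ω 0) ∂playLaw Q s₀ πC πR = f s₀ := by
  have hf : Measurable f := .of_discrete
  rw [playLaw, Kernel.lintegral_traj _ (by fun_prop)]
  simp [Function.updateFinset]

lemma map_playLaw_history_succ (t : ℕ) :
    (playLaw Q s₀ πC πR).map (fun ω => (Preorder.frestrictLe t ω, ω (t + 1))) =
      (playLaw Q s₀ πC πR).map (Preorder.frestrictLe t) ⊗ₘ stepKernel Q πC πR t := by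
  rw [playLaw, Kernel.traj_map_frestrictLe_apply]
  exact (Kernel.partialTraj_compProd_eq_map_traj (X := fun _ => S) (Nat.zero_le t)).symm

variable {Q s₀ πC πR}

lemma lintegral_playLaw_succ (t : ℕ) (f : (Finset.Iic t → S) → S → ℝ≥0∞) :
    ∫⁻ ω, f (Preorder.frestrictLe t ω) (ω (t + 1)) ∂playLaw Q s₀ πC πR =
      ∫⁻ ω, ∫⁻ s, f (Preorder.frestrictLe t ω) s ∂stepKernel Q πC πR t (Preorder.frestrictLe t ω)
        ∂playLaw Q s₀ πC πR := by
  have hf : Measurable (Function.uncurry f) := Measurable.of_discrete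
  have h := congrArg (fun μ => ∫⁻ z, Function.uncurry f z ∂μ)
    (map_playLaw_history_succ Q s₀ πC πR t)
  rwa [lintegral_map hf (by fun_prop), Measure.lintegral_compProd hf,
    lintegral_map Measurable.of_discrete (by fun_prop)] at h

lemma ae_stepKernel_exists_transition (t : ℕ) (h : Finset.Iic t → S) :
    ∀ᵐ s ∂stepKernel Q πC πR t h, ∃ a b, s = Q (lastPos h) a b := by
  refine (PMF.toMeasure_apply_eq_zero_iff _ .of_discrete).2 (Set.disjoint_left.2 ?_)
  simp only [PMF.mem_support_bind_iff, PMF.mem_support_map_iff]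
  rintro _ ⟨a, -, b, -, rfl⟩ hs
  exact hs ⟨a, b, rfl⟩

lemma ae_playLaw_exists_transition :
    ∀ᵐ ω ∂playLaw Q s₀ πC πR, ∀ t, ∃ a b, ω (t + 1) = Q (ω t) a b := by
  refine ae_all_iff.2 fun t => ?_
  have h : ∀ᵐ z ∂(playLaw Q s₀ πC πR).map (Preorder.frestrictLe t) ⊗ₘ stepKernel Q πC πR t,
      ∃ a b, z.2 = Q (lastPos z.1) a b :=
    (Measure.ae_compProd_iff .of_discrete).2
      (.of_forall fun h => ae_stepKernel_exists_transition t h)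
  rw [← map_playLaw_history_succ] at h
  exact ae_of_ae_map (f := fun ω => (Preorder.frestrictLe t ω, ω (t + 1))) (by fun_prop) h

section Potential

variable {c : S → ℝ≥0∞} {Φ : ℕ → S → ℝ≥0∞}

lemma lintegral_add_playLaw_succ (n : ℕ) :
    ∫⁻ ω, c (ω n) ∂playLaw Q s₀ πC πR + ∫⁻ ω, Φ (n + 1) (ω (n + 1)) ∂playLaw Q s₀ πC πR =
      ∫⁻ ω, (c (ω n) + ∫⁻ s, Φ (n + 1) s ∂stepKernel Q πC πR n (Preorder.frestrictLe n ω))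
        ∂playLaw Q s₀ πC πR := by
  have hc : Measurable c := .of_discrete
  rw [lintegral_playLaw_succ n fun _ s => Φ (n + 1) s, lintegral_add_left (by fun_prop)]

lemma sum_add_lintegral_le
    (hΦ : ∀ t (h : Finset.Iic t → S),
      c (lastPos h) + ∫⁻ s, Φ (t + 1) s ∂stepKernel Q πC πR t h ≤ Φ t (lastPos h)) (n : ℕ) :
    ∑ t ∈ Finset.range n, ∫⁻ ω, c (ω t) ∂playLaw Q s₀ πC πR +
      ∫⁻ ω, Φ n (ω n) ∂playLaw Q s₀ πC πR ≤ Φ 0 s₀ := by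
  induction n with
  | zero => simp [lintegral_playLaw_zero]
  | succ n ih =>
    refine le_trans ?_ ih
    rw [Finset.sum_range_succ, add_assoc, lintegral_add_playLaw_succ]
    gcongr with ω
    exact hΦ n (Preorder.frestrictLe n ω)

lemma le_sum_add_lintegral {n : ℕ}
    (hΦ : ∀ t < n, ∀ h : Finset.Iic t → S,
      Φ t (lastPos h) ≤ c (lastPos h) + ∫⁻ s, Φ (t + 1) s ∂stepKernel Q πC πR t h) :
    Φ 0 s₀ ≤ ∑ t ∈ Finset.range n, ∫⁻ ω, c (ω t) ∂playLaw Q s₀ πC πR +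
      ∫⁻ ω, Φ n (ω n) ∂playLaw Q s₀ πC πR := by
  induction n with
  | zero => simp [lintegral_playLaw_zero]
  | succ n ih =>
    refine (ih fun t ht => hΦ t (ht.trans n.lt_succ_self)).trans ?_
    rw [Finset.sum_range_succ, add_assoc, lintegral_add_playLaw_succ]
    gcongr with ω
    exact hΦ n n.lt_succ_self (Preorder.frestrictLe n ω)

end Potential

variable {t : ℕ} {h : Finset.Iic t → S} {f : S → ℝ≥0∞} {b : ℝ≥0∞}

lemma lintegral_stepKernel (f : S → ℝ≥0∞) :
    ∫⁻ s, f s ∂stepKernel Q πC πR t h =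
      ∑' u, πC t h u * ∑' w, πR t h w * f (Q (lastPos h) u w) := by
  classical
  change ∫⁻ s, f s ∂(PMF.toMeasure _) = _
  simp only [lintegral_countable', PMF.toMeasure_apply_singleton _ _ (MeasurableSet.singleton _),
    PMF.bind_apply, PMF.map_apply, ← ENNReal.tsum_mul_left]
  rw [ENNReal.tsum_comm]
  refine tsum_congr fun u => ?_
  rw [ENNReal.tsum_comm]
  exact tsum_congr fun w => by simp [lastPos, mul_comm, mul_left_comm]

lemma lintegral_stepKernel_le (hb : ∀ w, ∑' u, πC t h u * f (Q (lastPos h) u w) ≤ b) :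
    ∫⁻ s, f s ∂stepKernel Q πC πR t h ≤ b :=
  calc ∫⁻ s, f s ∂stepKernel Q πC πR t h
      = ∑' w, πR t h w * ∑' u, πC t h u * f (Q (lastPos h) u w) := by
        simp only [lintegral_stepKernel, ← ENNReal.tsum_mul_left, mul_left_comm (πR t h _)]
        exact ENNReal.tsum_comm
    _ ≤ ∑' w, πR t h w * b := by gcongr with w; exact hb w
    _ = b := by rw [ENNReal.tsum_mul_right, PMF.tsum_coe, one_mul]

lemma le_lintegral_stepKernel (hb : ∀ u, b ≤ ∑' w, πR t h w * f (Q (lastPos h) u w)) :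
    b ≤ ∫⁻ s, f s ∂stepKernel Q πC πR t h :=
  calc b = ∑' u, πC t h u * b := by rw [ENNReal.tsum_mul_right, PMF.tsum_coe, one_mul]
    _ ≤ ∑' u, πC t h u * ∑' w, πR t h w * f (Q (lastPos h) u w) := by gcongr with u; exact hb u
    _ = ∫⁻ s, f s ∂stepKernel Q πC πR t h := (lintegral_stepKernel f).symm

end PlayLaw

section RealFunction

variable {S : Type*}

lemma tendsto_norm_atTop_of_monotone [Fintype S] {a : ℕ → S → ℝ} (ha : Monotone a)
    (ha0 : ∀ n, 0 ≤ a n) (hbdd : ¬ BddAbove (Set.range a)) :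
    Tendsto (fun n => ‖a n‖) atTop atTop := by
  refine tendsto_atTop_atTop_of_monotone' (fun m n hmn => ?_) fun ⟨b, hb⟩ => hbdd ?_
  · refine (pi_norm_le_iff_of_nonneg (norm_nonneg _)).2 fun s => ?_
    rw [Real.norm_of_nonneg (ha0 m s)]
    exact (ha hmn s).trans ((le_abs_self _).trans (norm_le_pi_norm (a n) s))
  · refine ⟨fun _ => b, Set.forall_mem_range.2 fun n s => ?_⟩
    exact (le_abs_self _).trans ((norm_le_pi_norm (a n) s).trans (hb ⟨n, rfl⟩))

lemma exists_le_smul [Finite S] {c f : S → ℝ} (hc : 0 ≤ c) (hf : ∀ s, c s = 0 → f s = 0) :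
    ∃ k : ℝ, 0 ≤ k ∧ f ≤ k • c := by
  obtain ⟨b, hb⟩ := (Set.finite_range fun s => f s / c s).bddAbove
  refine ⟨max b 0, le_max_right _ _, fun s => ?_⟩
  obtain h | h := (hc s).eq_or_lt'
  · simp [h, hf s h]
  · exact (div_le_iff₀ h).1 ((hb ⟨s, rfl⟩).trans (le_max_left _ _))

end RealFunction

section StageOperators

variable {S A B : Type*} [Fintype A] [Fintype B] {Q : S → A → B → S} {T : Set S}
  {c v : S → ℝ}

/-- One round of the optimality equations without stage cost: the mixed-strategy value of the
matrix game in which the next position is paid according to `v`. -/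
noncomputable def nextValue (Q : S → A → B → S) (v : S → ℝ) (s : S) : ℝ :=
  matrixValue fun a b => v (Q s a b)

/-- One round of the optimality equations with the stage cost `c` at the current position. -/
noncomputable def bellman (Q : S → A → B → S) (c v : S → ℝ) : S → ℝ :=
  c + nextValue Q v

/-- A play that has reached `T` stays in `T`, whatever the players do. -/
def IsAbsorbing (Q : S → A → B → S) (T : Set S) : Prop :=
  ∀ s ∈ T, ∀ a b, Q s a b ∈ T

/-- The maximizing player cannot avoid `T` forever with positive probability. This is encoded
without strategies: a potential that vanishes on `T`, and that he can keep from decreasing in mean,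
is zero. -/
def Inescapable (Q : S → A → B → S) (T : Set S) : Prop :=
  ∀ p : S → ℝ, 0 ≤ p → (∀ s ∈ T, p s = 0) → p ≤ nextValue Q p → p = 0

lemma nextValue_smul {k : ℝ} (hk : 0 ≤ k) (v : S → ℝ) :
    nextValue Q (k • v) = k • nextValue Q v :=
  funext fun _ => matrixValue_smul hk _

lemma bellman_smul_le {k e : ℝ} (he : 0 ≤ e) (hk : 0 ≤ k) (hfix : bellman Q c v = v)
    (hv : v ≤ (k + 1) • c) :
    bellman Q c ((1 + e) • v) ≤ (1 + e * (k / (k + 1))) • v := fun s => by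
  have hnext : nextValue Q v s = v s - c s := eq_sub_of_add_eq' (congrFun hfix s)
  have hvs : v s / (k + 1) ≤ c s := (div_le_iff₀' (by positivity)).2 (hv s)
  calc bellman Q c ((1 + e) • v) s = v s + e * (v s - c s) := by
        rw [bellman, nextValue_smul (by positivity)]
        simp only [Pi.add_apply, Pi.smul_apply, smul_eq_mul, hnext]
        ring
    _ ≤ v s + e * (v s - v s / (k + 1)) := by gcongr
    _ = ((1 + e * (k / (k + 1))) • v) s := by
        simp only [Pi.smul_apply, smul_eq_mul]
        field_simp
        ring

variable [Nonempty A] [Nonempty B]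

lemma nextValue_mono : Monotone (nextValue Q) := fun _ _ h _ =>
  matrixValue_mono fun _ _ => h _

lemma nextValue_nonneg (hv : 0 ≤ v) : 0 ≤ nextValue Q v := fun s =>
  (matrixValue_const 0).ge.trans (matrixValue_mono fun a b => hv (Q s a b))

lemma continuous_nextValue : Continuous (nextValue Q) := continuous_pi fun s =>
  lipschitzWith_matrixValue.continuous.comp (by fun_prop)

lemma IsAbsorbing.nextValue_eq_zero (hT : IsAbsorbing Q T) (hv : ∀ s ∈ T, v s = 0) :
    ∀ s ∈ T, nextValue Q v s = 0 := fun s hs => by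
  simp only [nextValue, hv _ (hT s hs _ _), matrixValue_const]

lemma bellman_mono : Monotone (bellman Q c) := fun _ _ h =>
  add_le_add_right (nextValue_mono h) c

lemma bellman_nonneg (hc : 0 ≤ c) (hv : 0 ≤ v) : 0 ≤ bellman Q c v :=
  add_nonneg hc (nextValue_nonneg hv)

lemma continuous_bellman : Continuous (bellman Q c) :=
  continuous_nextValue.const_add c

lemma monotone_bellman_iterate_zero (hc : 0 ≤ c) : Monotone fun n => (bellman Q c)^[n] 0 :=
  bellman_mono.monotone_iterate_of_le_map (bellman_nonneg hc le_rfl)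

lemma bellman_iterate_zero_nonneg (hc : 0 ≤ c) (n : ℕ) : 0 ≤ (bellman Q c)^[n] 0 :=
  monotone_bellman_iterate_zero hc n.zero_le

lemma IsAbsorbing.bellman_iterate_zero_eq_zero (hT : IsAbsorbing Q T) (hcT : ∀ s ∈ T, c s = 0)
    (n : ℕ) : ∀ s ∈ T, (bellman Q c)^[n] 0 s = 0 := by
  induction n with
  | zero => exact fun _ _ => rfl
  | succ n ih =>
    intro s hs
    rw [Function.iterate_succ_apply', bellman, Pi.add_apply, hcT s hs,
      hT.nextValue_eq_zero ih s hs, add_zero]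

lemma Inescapable.of_factor {S' A' : Type*} [Fintype A'] [Nonempty A'] {Q' : S' → A' → B → S'}
    {φ : S' → S} {ψ : A' → A} (h : Inescapable Q' (φ ⁻¹' T)) (hφ : Function.Surjective φ)
    (hQ : ∀ s a b, φ (Q' s a b) = Q (φ s) (ψ a) b) : Inescapable Q T := by
  intro p hp hpT hle
  have hle' : p ∘ φ ≤ nextValue Q' (p ∘ φ) := fun s => by
    obtain ⟨q, hq, hqv⟩ := (exists_optimal_mixed_actions fun a b => p (Q (φ s) a b)).2
    refine (hle (φ s)).trans (le_matrixValue hq fun a => (hqv (ψ a)).trans_eq ?_)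
    simp only [Function.comp_apply, hQ]
  have h0 : p ∘ φ = 0 := h (p ∘ φ) (fun s => hp (φ s)) (fun s => hpT (φ s)) hle'
  exact hφ.injective_comp_right h0

theorem Inescapable.bddAbove_range_bellman_iterate [Finite S] (hQ : Inescapable Q T)
    (hT : IsAbsorbing Q T) (hc : 0 ≤ c) (hcT : ∀ s ∈ T, c s = 0) :
    BddAbove (Set.range fun n => (bellman Q c)^[n] 0) := by
  have := Fintype.ofFinite S
  by_contra hbdd
  set a : ℕ → S → ℝ := fun n => (bellman Q c)^[n] 0
  have ha : Monotone a := monotone_bellman_iterate_zero hc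
  have ha0 (n) : 0 ≤ a n := bellman_iterate_zero_nonneg hc n
  have hnorm : Tendsto (fun n => ‖a n‖) atTop atTop := tendsto_norm_atTop_of_monotone ha ha0 hbdd
  let x : ℕ → S → ℝ := fun n => ‖a n‖⁻¹ • a n
  have hx (n) : x n ≤ ‖a n‖⁻¹ • c + nextValue Q (x n) := by
    rw [nextValue_smul (by positivity), ← smul_add]
    refine smul_le_smul_of_nonneg_left ((ha n.le_succ).trans_eq ?_) (by positivity)
    exact Function.iterate_succ_apply' _ _ _
  obtain ⟨p, -, φ, hφ, hp⟩ := (isCompact_closedBall (0 : S → ℝ) 1).tendsto_subseq (x := x)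
    fun n => by simp [x, norm_smul, inv_mul_le_one]
  have hφnorm : Tendsto (fun n => ‖a (φ n)‖) atTop atTop := hnorm.comp hφ.tendsto_atTop
  have hp0 : 0 ≤ p := ge_of_tendsto' hp fun n => smul_nonneg (by positivity) (ha0 _)
  have hpT : ∀ s ∈ T, p s = 0 := fun s hs => by
    refine tendsto_nhds_unique (tendsto_pi_nhds.1 hp s) ?_
    simp [x, a, hT.bellman_iterate_zero_eq_zero hcT _ s hs]
  have hle : p ≤ nextValue Q p := by
    refine le_of_tendsto_of_tendsto' hp ?_ fun n => hx (φ n)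
    simpa using (hφnorm.inv_tendsto_atTop.smul_const c).add
      ((continuous_nextValue (Q := Q).tendsto p).comp hp)
  have hp1 : ‖p‖ = 1 := by
    refine tendsto_nhds_unique hp.norm (tendsto_const_nhds.congr' ?_)
    filter_upwards [hφnorm.eventually_gt_atTop 0] with n hn
    simp [x, norm_smul, hn.ne']
  simp [hQ p hp0 hpT hle] at hp1

theorem Inescapable.exists_tendsto_bellman_iterate [Finite S] (hQ : Inescapable Q T)
    (hT : IsAbsorbing Q T) (hc : 0 ≤ c) (hcT : ∀ s ∈ T, c s = 0) :
    ∃ v : S → ℝ, Tendsto (fun n => (bellman Q c)^[n] 0) atTop (𝓝 v) :=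
  ⟨_, tendsto_atTop_ciSup (monotone_bellman_iterate_zero hc)
    (hQ.bddAbove_range_bellman_iterate hT hc hcT)⟩

section Limit

variable (hlim : Tendsto (fun n => (bellman Q c)^[n] 0) atTop (𝓝 v))
include hlim

lemma bellman_eq_of_tendsto_iterate : bellman Q c v = v :=
  isFixedPt_of_tendsto_iterate hlim continuous_bellman.continuousAt

lemma nonneg_of_tendsto_bellman_iterate (hc : 0 ≤ c) : 0 ≤ v :=
  ge_of_tendsto' hlim (bellman_iterate_zero_nonneg hc)

lemma cost_le_of_tendsto_bellman_iterate (hc : 0 ≤ c) : c ≤ v :=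
  (le_add_of_nonneg_right (nextValue_nonneg (nonneg_of_tendsto_bellman_iterate hlim hc))).trans_eq
    (bellman_eq_of_tendsto_iterate hlim)

lemma IsAbsorbing.eq_zero_of_tendsto_bellman_iterate (hT : IsAbsorbing Q T)
    (hcT : ∀ s ∈ T, c s = 0) : ∀ s ∈ T, v s = 0 := fun s hs => by
  refine tendsto_nhds_unique (tendsto_pi_nhds.1 hlim s) ?_
  simp [hT.bellman_iterate_zero_eq_zero hcT _ s hs]

lemma le_of_bellman_le {f : S → ℝ} (hf : 0 ≤ f) (hle : bellman Q c f ≤ f) : v ≤ f :=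
  le_of_tendsto' hlim fun n =>
    (bellman_mono.iterate n hf).trans (bellman_mono.antitone_iterate_of_map_le hle n.zero_le)

theorem tendsto_of_forall_succ_eq_bellman [Finite S] (hc : 0 ≤ c)
    (hvc : ∀ s, c s = 0 → v s = 0) {x : ℕ → S → ℝ} (hx0 : 0 ≤ x 0)
    (hxc : ∀ s, c s = 0 → x 0 s = 0) (hx : ∀ n, x (n + 1) = bellman Q c (x n)) :
    Tendsto x atTop (𝓝 v) := by
  have hfix := bellman_eq_of_tendsto_iterate hlim
  have hv0 := nonneg_of_tendsto_bellman_iterate hlim hc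
  have hcv := cost_le_of_tendsto_bellman_iterate hlim hc
  obtain ⟨k, hk, hvk⟩ := exists_le_smul hc hvc
  obtain ⟨e, he, hxe⟩ := exists_le_smul hc hxc
  have hvk' : v ≤ (k + 1) • c := hvk.trans (smul_le_smul_of_nonneg_right (by simp) hc)
  have hx0v : x 0 ≤ (1 + e) • v := (hxe.trans (smul_le_smul_of_nonneg_left hcv he)).trans
    (smul_le_smul_of_nonneg_right (by simp) hv0)
  set a := k / (k + 1)
  have ha1 : a < 1 := (div_lt_one (by positivity)).2 (by simp)
  have hupper (n) : x n ≤ (1 + e * a ^ n) • v :=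
    bellman_mono.seq_le_seq (y := fun n => (1 + e * a ^ n) • v) n (by simpa using hx0v)
      (fun m _ => (hx m).le) fun m _ => by
        simpa only [pow_succ, mul_assoc] using
          bellman_smul_le (e := e * a ^ m) (by positivity) hk hfix hvk'
  have hlower (n) : (bellman Q c)^[n] 0 ≤ x n :=
    bellman_mono.seq_le_seq (x := fun n => (bellman Q c)^[n] 0) n hx0
      (fun m _ => (Function.iterate_succ_apply' _ m 0).le) fun m _ => (hx m).ge
  have hlim' : Tendsto (fun n => (1 + e * a ^ n) • v) atTop (𝓝 v) := by
    simpa using (((tendsto_pow_atTop_nhds_zero_of_lt_one (by positivity) ha1).const_mul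
      e).const_add 1).smul_const v
  exact tendsto_pi_nhds.2 fun s => tendsto_of_tendsto_of_tendsto_of_le_of_le
    (tendsto_pi_nhds.1 hlim s) (tendsto_pi_nhds.1 hlim' s) (fun n => hlower n s) fun n => hupper n s

end Limit

end StageOperators

section Strategies

lemma exists_pmf_tsum_mul_ofReal {I : Type*} [Fintype I] {p : I → ℝ} (hp : p ∈ stdSimplex ℝ I) :
    ∃ P : PMF I, ∀ f : I → ℝ, 0 ≤ f →
      ∑' i, P i * ENNReal.ofReal (f i) = ENNReal.ofReal (∑ i, p i * f i) := by
  have hsum : ∑ i, ENNReal.ofReal (p i) = 1 := by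
    rw [← ENNReal.ofReal_sum_of_nonneg fun i _ => hp.1 i, hp.2, ENNReal.ofReal_one]
  refine ⟨PMF.ofFintype (fun i => ENNReal.ofReal (p i)) hsum, fun f hf => ?_⟩
  rw [tsum_fintype, ENNReal.ofReal_sum_of_nonneg fun i _ => mul_nonneg (hp.1 i) (hf i)]
  exact Finset.sum_congr rfl fun i _ => (ENNReal.ofReal_mul (hp.1 i)).symm

variable {S A B : Type*} [MeasurableSpace S] [DiscreteMeasurableSpace S] [Finite S]
  {Q : S → A → B → S} {T : Set S}

lemma IsAbsorbing.ae_eventually_mem (hT : IsAbsorbing Q T) {s₀ : S} {πC : Strategy S A}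
    {πR : Strategy S B} (hreach : ∀ᵐ ω ∂playLaw Q s₀ πC πR, ∃ t, ω t ∈ T) :
    ∀ᵐ ω ∂playLaw Q s₀ πC πR, ∀ᶠ n in atTop, ω n ∈ T := by
  filter_upwards [hreach, ae_playLaw_exists_transition] with ω ⟨t, ht⟩ hω
  filter_upwards [eventually_ge_atTop t] with n hn
  induction n, hn using Nat.le_induction with
  | base => exact ht
  | succ n _ ih =>
    obtain ⟨a, b, h⟩ := hω n
    exact h ▸ hT _ ih a b

variable [Fintype A] [Nonempty A] [Fintype B] [Nonempty B]

lemma exists_strategy_lintegral_stepKernel_le {f : ℕ → S → ℝ} (hf : 0 ≤ f) :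
    ∃ πC : Strategy S A, ∀ (πR : Strategy S B) t (h : Finset.Iic t → S),
      ∫⁻ s, ENNReal.ofReal (f t s) ∂stepKernel Q πC πR t h ≤
        ENNReal.ofReal (nextValue Q (f t) (lastPos h)) := by
  choose p hp hpv using fun t s => (exists_optimal_mixed_actions fun u w => f t (Q s u w)).1
  choose P hP using fun t s => exists_pmf_tsum_mul_ofReal (hp t s)
  refine ⟨fun t h => P t (lastPos h), fun πR t h => lintegral_stepKernel_le fun w => ?_⟩
  rw [hP t (lastPos h) (fun u => f t (Q (lastPos h) u w)) fun u => hf t _]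
  exact ENNReal.ofReal_le_ofReal (hpv t _ w)

lemma exists_strategy_le_lintegral_stepKernel {f : ℕ → S → ℝ} (hf : 0 ≤ f) :
    ∃ πR : Strategy S B, ∀ (πC : Strategy S A) t (h : Finset.Iic t → S),
      ENNReal.ofReal (nextValue Q (f t) (lastPos h)) ≤
        ∫⁻ s, ENNReal.ofReal (f t s) ∂stepKernel Q πC πR t h := by
  choose q hq hqv using fun t s => (exists_optimal_mixed_actions fun u w => f t (Q s u w)).2
  choose P hP using fun t s => exists_pmf_tsum_mul_ofReal (hq t s)
  refine ⟨fun t h => P t (lastPos h), fun πC t h => le_lintegral_stepKernel fun u => ?_⟩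
  rw [hP t (lastPos h) (fun w => f t (Q (lastPos h) u w)) fun w => hf t _]
  exact ENNReal.ofReal_le_ofReal (hqv t _ u)

theorem IsAbsorbing.inescapable (hT : IsAbsorbing Q T)
    (hreach : ∀ s, ∃ πC : Strategy S A, ∀ πR : Strategy S B,
      ∀ᵐ ω ∂playLaw Q s πC πR, ∃ t, ω t ∈ T) : Inescapable Q T := by
  refine fun p hp hpT hle => le_antisymm (fun s => ?_) hp
  obtain ⟨πC, hπC⟩ := hreach s
  obtain ⟨πR, hπR⟩ := exists_strategy_le_lintegral_stepKernel (A := A) (Q := Q)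
    (f := fun _ => p) fun _ => hp
  set μ := playLaw Q s πC πR
  have hlower (n) : ENNReal.ofReal (p s) ≤ ∫⁻ ω, ENNReal.ofReal (p (ω n)) ∂μ := by
    simpa using le_sum_add_lintegral (Q := Q) (s₀ := s) (πC := πC) (πR := πR) (n := n) (c := 0)
      (Φ := fun _ s => ENNReal.ofReal (p s)) fun t _ h => by
        simpa using (ENNReal.ofReal_le_ofReal (hle _)).trans (hπR πC t h)
  have hlim : Tendsto (fun n => ∫⁻ ω, ENNReal.ofReal (p (ω n)) ∂μ) atTop (𝓝 0) := by
    obtain ⟨b, hb⟩ := (Set.finite_range p).bddAbove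
    rw [← lintegral_zero (μ := μ)]
    refine tendsto_lintegral_of_dominated_convergence (fun _ => ENNReal.ofReal b) (fun n => ?_)
      (fun n => .of_forall fun ω => ENNReal.ofReal_le_ofReal (hb ⟨ω n, rfl⟩)) (by simp) ?_
    · have hp : Measurable p := .of_discrete
      fun_prop
    · filter_upwards [hT.ae_eventually_mem (hπC πR)] with ω hω
      refine tendsto_const_nhds.congr' ?_
      filter_upwards [hω] with n hn
      simp [hpT _ hn]
  exact ENNReal.ofReal_eq_zero.1 (nonpos_iff_eq_zero.1 (ge_of_tendsto' hlim hlower))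

end Strategies

section Value

/-- The game with payoff `f`, minimized by the first and maximized by the second player, has the
value `a`. -/
def IsMinimaxValue {X Y : Type*} (f : X → Y → ℝ≥0∞) (a : ℝ≥0∞) : Prop :=
  (⨅ x, ⨆ y, f x y) = a ∧ (⨆ y, ⨅ x, f x y) = a

lemma isMinimaxValue_of_le {X Y : Type*} {f : X → Y → ℝ≥0∞} {a : ℝ≥0∞}
    (hupper : ⨅ x, ⨆ y, f x y ≤ a) (hlower : a ≤ ⨆ y, ⨅ x, f x y) : IsMinimaxValue f a :=
  have hle : ⨆ y, ⨅ x, f x y ≤ ⨅ x, ⨆ y, f x y := iSup_iInf_le_iInf_iSup _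
  ⟨hupper.antisymm (hlower.trans hle), (hle.trans hupper).antisymm hlower⟩

lemma IsMinimaxValue.of_const_add {X Y : Type*} [Nonempty Y] {f : X → Y → ℝ≥0∞}
    {a b : ℝ≥0∞} (hb : b ≠ ⊤) (h : IsMinimaxValue (fun x y => b + f x y) (b + a)) :
    IsMinimaxValue f a := by
  simpa only [IsMinimaxValue, ← ENNReal.add_iSup, ← ENNReal.add_iInf,
    ENNReal.add_right_inj hb] using h

variable {S A B : Type*} [MeasurableSpace S] [DiscreteMeasurableSpace S] [Finite S]

/-- The expected total cost of the play, without the costs at the times before `k`. -/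
noncomputable def totalCost (Q : S → A → B → S) (c : S → ℝ) (k : ℕ) (s₀ : S) (πC : Strategy S A)
    (πR : Strategy S B) : ℝ≥0∞ :=
  ∫⁻ ω, ∑' t, ENNReal.ofReal (c (ω (k + t))) ∂playLaw Q s₀ πC πR

variable {Q : S → A → B → S} {c v : S → ℝ} {s₀ : S}

lemma totalCost_eq_tsum (k : ℕ) (πC : Strategy S A) (πR : Strategy S B) :
    totalCost Q c k s₀ πC πR =
      ∑' t, ∫⁻ ω, ENNReal.ofReal (c (ω (k + t))) ∂playLaw Q s₀ πC πR := by
  have hc : Measurable fun s => ENNReal.ofReal (c s) := .of_discrete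
  exact lintegral_tsum fun t => (hc.comp (measurable_pi_apply (k + t))).aemeasurable

lemma totalCost_zero_eq_add (πC : Strategy S A) (πR : Strategy S B) :
    totalCost Q c 0 s₀ πC πR = ENNReal.ofReal (c s₀) + totalCost Q c 1 s₀ πC πR := by
  simp only [totalCost_eq_tsum, zero_add, add_comm 1]
  rw [tsum_eq_zero_add' ENNReal.summable,
    lintegral_playLaw_zero Q s₀ πC πR fun s => ENNReal.ofReal (c s)]

variable [Nonempty B]

lemma IsMinimaxValue.totalCost_one (hc : 0 ≤ c) (hcv : c ≤ v) {s : S}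
    (h : IsMinimaxValue (totalCost Q c 0 s) (ENNReal.ofReal (v s))) :
    IsMinimaxValue (totalCost Q c 1 s) (ENNReal.ofReal ((v - c) s)) := by
  have : Nonempty (Strategy S B) := ⟨fun _ _ => PMF.pure (Classical.arbitrary B)⟩
  have hv : ENNReal.ofReal (v s) = ENNReal.ofReal (c s) + ENNReal.ofReal ((v - c) s) := by
    rw [Pi.sub_apply, ← ENNReal.ofReal_add (hc s) (sub_nonneg.2 (hcv s)), add_sub_cancel]
  refine .of_const_add ENNReal.ofReal_ne_top (b := ENNReal.ofReal (c s)) ?_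
  simpa only [← totalCost_zero_eq_add, ← hv] using h

variable [Fintype A] [Nonempty A] [Fintype B]

lemma exists_strategy_totalCost_le (hc : 0 ≤ c) (hv : 0 ≤ v) (hle : bellman Q c v ≤ v) :
    ∃ πC : Strategy S A, ∀ s (πR : Strategy S B),
      totalCost Q c 0 s πC πR ≤ ENNReal.ofReal (v s) := by
  obtain ⟨πC, hπC⟩ := exists_strategy_lintegral_stepKernel_le (B := B) (Q := Q)
    (f := fun _ => v) fun _ => hv
  refine ⟨πC, fun s πR => ?_⟩
  rw [totalCost_eq_tsum]
  refine ENNReal.tsum_le_of_sum_range_le fun n => ?_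
  simp only [zero_add]
  refine le_self_add.trans (sum_add_lintegral_le (c := fun s => ENNReal.ofReal (c s))
    (Φ := fun _ s => ENNReal.ofReal (v s)) (fun t h => ?_) n)
  calc ENNReal.ofReal (c (lastPos h)) + ∫⁻ s, ENNReal.ofReal (v s) ∂stepKernel Q πC πR t h
      ≤ ENNReal.ofReal (c (lastPos h)) + ENNReal.ofReal (nextValue Q v (lastPos h)) := by
        gcongr; exact hπC πR t h
    _ = ENNReal.ofReal (bellman Q c v (lastPos h)) :=
        (ENNReal.ofReal_add (hc _) (nextValue_nonneg hv _)).symm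
    _ ≤ ENNReal.ofReal (v (lastPos h)) := ENNReal.ofReal_le_ofReal (hle _)

lemma exists_strategy_le_totalCost (hc : 0 ≤ c) (n : ℕ) :
    ∃ πR : Strategy S B, ∀ s (πC : Strategy S A),
      ENNReal.ofReal ((bellman Q c)^[n] 0 s) ≤ totalCost Q c 0 s πC πR := by
  have h0 := bellman_iterate_zero_nonneg (Q := Q) hc
  obtain ⟨πR, hπR⟩ := exists_strategy_le_lintegral_stepKernel (Q := Q) (A := A)
    (f := fun t => (bellman Q c)^[n - (t + 1)] 0) fun t => h0 _
  refine ⟨πR, fun s πC => ?_⟩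
  have hsum := le_sum_add_lintegral (Q := Q) (s₀ := s) (πC := πC) (πR := πR) (n := n)
    (c := fun s => ENNReal.ofReal (c s))
    (Φ := fun t s => ENNReal.ofReal ((bellman Q c)^[n - t] 0 s)) fun t ht h => by
      rw [show n - t = n - (t + 1) + 1 by omega, Function.iterate_succ_apply', bellman,
        Pi.add_apply, ENNReal.ofReal_add (hc _) (nextValue_nonneg (h0 _) _)]
      gcongr
      exact hπR πC t h
  rw [totalCost_eq_tsum]
  refine le_trans ?_ (ENNReal.sum_le_tsum (Finset.range n))
  simpa using hsum

theorem isMinimaxValue_totalCost_zero (hc : 0 ≤ c)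
    (hlim : Tendsto (fun n => (bellman Q c)^[n] 0) atTop (𝓝 v)) (s : S) :
    IsMinimaxValue (totalCost Q c 0 s) (ENNReal.ofReal (v s)) := by
  refine isMinimaxValue_of_le ?_ ?_
  · obtain ⟨πC, h⟩ := exists_strategy_totalCost_le hc
      (nonneg_of_tendsto_bellman_iterate hlim hc) (bellman_eq_of_tendsto_iterate hlim).le
    exact iInf_le_of_le πC (iSup_le (h s))
  · refine le_of_tendsto' (ENNReal.tendsto_ofReal (tendsto_pi_nhds.1 hlim s)) fun n => ?_
    obtain ⟨πR, h⟩ := exists_strategy_le_totalCost (A := A) (Q := Q) hc n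
    exact le_iSup_of_le πR (le_iInf (h s))

end Value

section TargetShapley

variable {S A B : Type*} [Fintype A] [Fintype B] {Q : S → A → B → S} {T : Set S} {c v : S → ℝ}

open Classical in
/-- The right-hand side of the optimality equations with target `T`: it is `0` on `T`, and `ρ s s'`
is the payment for the round that leads from `s` to `s'`. For the game with one cop this is
`shapley`. -/
noncomputable def targetShapley (Q : S → A → B → S) (T : Set S) (ρ : S → S → ℝ) (v : S → ℝ)
    (s : S) : ℝ :=
  if s ∈ T then 0 else matrixValue fun a b => ρ s (Q s a b) + v (Q s a b)

lemma targetShapley_of_mem (ρ : S → S → ℝ) (v : S → ℝ) : ∀ s ∈ T, targetShapley Q T ρ v s = 0 :=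
  fun _ hs => if_pos hs

lemma eq_zero_of_succ_eq_targetShapley {ρ : S → S → ℝ} {x : ℕ → S → ℝ} (h0 : ∀ s ∈ T, x 0 s = 0)
    (hx : ∀ n, x (n + 1) = targetShapley Q T ρ (x n)) : ∀ n, ∀ s ∈ T, x n s = 0
  | 0 => h0
  | n + 1 => hx n ▸ targetShapley_of_mem ρ (x n)

variable [Nonempty A] [Nonempty B]

lemma targetShapley_next_eq_nextValue (hT : IsAbsorbing Q T) (hcT : ∀ s ∈ T, c s = 0)
    (hvT : ∀ s ∈ T, v s = 0) :
    targetShapley Q T (fun _ s' => c s') v = nextValue Q (c + v) := by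
  ext s
  by_cases hs : s ∈ T
  · rw [targetShapley_of_mem _ _ s hs, hT.nextValue_eq_zero (fun s hs => ?_) s hs]
    rw [Pi.add_apply, hcT s hs, hvT s hs, add_zero]
  · exact if_neg hs

lemma targetShapley_current_eq_bellman (hT : IsAbsorbing Q T) (hcT : ∀ s ∈ T, c s = 0)
    (hvT : ∀ s ∈ T, v s = 0) :
    targetShapley Q T (fun s _ => c s) v = bellman Q c v := by
  ext s
  by_cases hs : s ∈ T
  · rw [targetShapley_of_mem _ _ s hs, bellman, Pi.add_apply, hcT s hs,
      hT.nextValue_eq_zero hvT s hs, add_zero]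
  · exact (if_neg hs).trans (matrixValue_const_add _ _)

lemma add_targetShapley_next_eq_bellman (hT : IsAbsorbing Q T) (hcT : ∀ s ∈ T, c s = 0)
    (hvT : ∀ s ∈ T, v s = 0) :
    c + targetShapley Q T (fun _ s' => c s') v = bellman Q c (c + v) :=
  congrArg (c + ·) (targetShapley_next_eq_nextValue hT hcT hvT)

section Limit

variable (hT : IsAbsorbing Q T) (hc : 0 ≤ c) (hcT : ∀ s ∈ T, c s = 0)
  (hlim : Tendsto (fun n => (bellman Q c)^[n] 0) atTop (𝓝 v))
include hT hc hcT hlim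

lemma isLeast_fixedPoints_targetShapley_current :
    IsLeast {f : S → ℝ | (∀ s, 0 ≤ f s) ∧
      ∀ s, f s = targetShapley Q T (fun s _ => c s) f s} v := by
  refine ⟨⟨nonneg_of_tendsto_bellman_iterate hlim hc, congrFun ?_⟩, fun f ⟨hf, hfix⟩ => ?_⟩
  · rw [targetShapley_current_eq_bellman hT hcT (hT.eq_zero_of_tendsto_bellman_iterate hlim hcT),
      bellman_eq_of_tendsto_iterate hlim]
  · have hfT : ∀ s ∈ T, f s = 0 := fun s hs => (hfix s).trans (targetShapley_of_mem _ f s hs)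
    exact le_of_bellman_le hlim hf
      (targetShapley_current_eq_bellman hT hcT hfT ▸ (funext hfix).ge)

lemma isLeast_fixedPoints_targetShapley_next :
    IsLeast {f : S → ℝ | (∀ s, 0 ≤ f s) ∧
      ∀ s, f s = targetShapley Q T (fun _ s' => c s') f s} (v - c) := by
  have hcv := cost_le_of_tendsto_bellman_iterate hlim hc
  have hvT := hT.eq_zero_of_tendsto_bellman_iterate hlim hcT
  refine ⟨⟨sub_nonneg.2 hcv, congrFun ?_⟩, fun f ⟨hf, hfix⟩ => ?_⟩
  · refine add_left_cancel (a := c) ?_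
    rw [add_targetShapley_next_eq_bellman hT hcT fun s hs => by simp [hvT s hs, hcT s hs],
      add_sub_cancel, bellman_eq_of_tendsto_iterate hlim]
  · have hfT : ∀ s ∈ T, f s = 0 := fun s hs => (hfix s).trans (targetShapley_of_mem _ f s hs)
    refine sub_le_iff_le_add'.2 (le_of_bellman_le hlim (add_nonneg hc hf) ?_)
    rw [← add_targetShapley_next_eq_bellman hT hcT hfT, ← funext hfix]

variable [Finite S] (hcT' : ∀ s, c s = 0 → s ∈ T) {x : ℕ → S → ℝ} (hx0 : 0 ≤ x 0)
  (hxT : ∀ s ∈ T, x 0 s = 0)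
include hcT' hx0 hxT

lemma tendsto_valueIteration_current
    (hx : ∀ n s, x (n + 1) s = targetShapley Q T (fun s _ => c s) (x n) s) :
    Tendsto x atTop (𝓝 v) := by
  have hvT := hT.eq_zero_of_tendsto_bellman_iterate hlim hcT
  have hxT' := eq_zero_of_succ_eq_targetShapley hxT fun n => funext (hx n)
  exact tendsto_of_forall_succ_eq_bellman hlim hc (fun s hs => hvT s (hcT' s hs)) hx0
    (fun s hs => hxT s (hcT' s hs))
    fun n => (funext (hx n)).trans (targetShapley_current_eq_bellman hT hcT (hxT' n))

lemma tendsto_valueIteration_next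
    (hx : ∀ n s, x (n + 1) s = targetShapley Q T (fun _ s' => c s') (x n) s) :
    Tendsto x atTop (𝓝 (v - c)) := by
  have hvT := hT.eq_zero_of_tendsto_bellman_iterate hlim hcT
  have hxT' := eq_zero_of_succ_eq_targetShapley hxT fun n => funext (hx n)
  have hshift : Tendsto (fun n => c + x n) atTop (𝓝 v) :=
    tendsto_of_forall_succ_eq_bellman hlim hc (fun s hs => hvT s (hcT' s hs)) (add_nonneg hc hx0)
      (fun s hs => by simp [hxT s (hcT' s hs), hs])
      fun n => by rw [← add_targetShapley_next_eq_bellman hT hcT (hxT' n), ← funext (hx n)]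
  simpa using hshift.sub_const c

end Limit

end TargetShapley

section OneCop

variable {V : Type*} {G : SimpleGraph V}

/-- The positions in which a single cop has captured the robber. -/
def captureSet (V : Type*) : Set (Position V V) := {s | s.cop = s.robber}

lemma forall_mem_captureSet {p : Position V V → Prop} :
    (∀ s ∈ captureSet V, p s) ↔ ∀ x, p ⟨x, x⟩ :=
  ⟨fun h x => h ⟨x, x⟩ rfl, fun h ⟨x, _⟩ hs => by cases hs; exact h x⟩

lemma reward_nonneg : 0 ≤ reward (V := V) := fun s => by
  rw [reward]; split <;> simp

lemma reward_eq_zero_iff (s : Position V V) : reward s = 0 ↔ s ∈ captureSet V := by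
  simp [reward, captureSet]

lemma isAbsorbing_nextPos : IsAbsorbing (nextPos G) (captureSet V) := fun s hs u w => by
  have h : s.cop = s.robber := hs
  rwa [nextPos, if_pos h]

lemma isAbsorbing_nextPosK {K : ℕ} :
    IsAbsorbing (nextPosK G (K := K)) {s | Captured s} := fun s hs u w => by
  have h : Captured s := hs
  rwa [nextPosK, if_pos h]

/-- A position of the game with a one-element team of cops, as a position of the game with one
cop. -/
def singleCop (s : Position (Fin 1 → V) V) : Position V V := ⟨s.cop 0, s.robber⟩

lemma singleCop_surjective : Function.Surjective (singleCop (V := V)) :=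
  fun s => ⟨⟨fun _ => s.cop, s.robber⟩, rfl⟩

lemma captured_iff_singleCop_mem (s : Position (Fin 1 → V) V) :
    Captured s ↔ singleCop s ∈ captureSet V :=
  Fin.exists_fin_one

lemma singleCop_nextPosK (s : Position (Fin 1 → V) V) (u : Fin 1 → V) (w : V) :
    singleCop (nextPosK G s u w) = nextPos G (singleCop s) (u 0) w := by
  have hcap := captured_iff_singleCop_mem s
  simp only [nextPosK, nextPos, hcap, Fin.exists_fin_one]
  split_ifs <;> simp_all [singleCop, captureSet]

lemma copsSuffice_of_concurrentCopNumber_eq [Finite V] {K : ℕ} (hK : K ≠ 0)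
    (h : concurrentCopNumber G = K) : CopsSuffice G K := by
  have hne : {K | 1 ≤ K ∧ CopsSuffice G K}.Nonempty := Nat.nonempty_of_pos_sInf (by
    rw [← concurrentCopNumber, h]; exact hK.bot_lt)
  exact h ▸ (Nat.sInf_mem hne).2

lemma CopsSuffice.inescapable {K : ℕ} [Fintype V] [Nonempty V] (h : CopsSuffice G K) :
    Inescapable (nextPosK G (K := K)) {s | Captured s} := by
  refine isAbsorbing_nextPosK.inescapable fun s => ?_
  obtain ⟨πC, hπC⟩ := h s
  have hmeas : MeasurableSet {ω : ℕ → Position (Fin K → V) V | ∃ t, Captured (ω t)} :=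
    measurableSet_setOfPred.2 <| .exists fun t =>
      (Measurable.of_discrete (f := Captured)).comp (measurable_pi_apply t)
  exact ⟨πC, fun πR => (mem_ae_iff_prob_eq_one hmeas).2 (hπC πR)⟩

lemma inescapable_captureSet [Fintype V] [Nonempty V] (h : concurrentCopNumber G = 1) :
    Inescapable (nextPos G) (captureSet V) := by
  have hpre : {s : Position (Fin 1 → V) V | Captured s} = singleCop ⁻¹' captureSet V :=
    Set.ext captured_iff_singleCop_mem
  have hteam := (copsSuffice_of_concurrentCopNumber_eq one_ne_zero h).inescapable
  rw [hpre] at hteam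
  exact hteam.of_factor (ψ := fun u => u 0) singleCop_surjective singleCop_nextPosK

end OneCop

end CCCR

theorem theorem4p6_general {S A B : Type*} [MeasurableSpace S] [DiscreteMeasurableSpace S]
    [Finite S] [Fintype A] [Nonempty A] [Fintype B] [Nonempty B] {Q : S → A → B → S} {T : Set S}
    {c : S → ℝ} (hQ : Inescapable Q T) (hT : IsAbsorbing Q T) (hc : 0 ≤ c)
    (hcT : ∀ s, c s = 0 ↔ s ∈ T) :
    (∃ v : S → ℝ,
      (∀ s, IsMinimaxValue (totalCost Q c 0 s) (ENNReal.ofReal (v s))) ∧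
      IsLeast {v' : S → ℝ | (∀ s, 0 ≤ v' s) ∧
        ∀ s, v' s = targetShapley Q T (fun s _ => c s) v' s} v ∧
      ∀ vn : ℕ → S → ℝ, (∀ s, 0 ≤ vn 0 s) → (∀ s ∈ T, vn 0 s = 0) →
        (∀ n s, vn (n + 1) s = targetShapley Q T (fun s _ => c s) (vn n) s) →
        ∀ s, Tendsto (fun n => vn n s) atTop (𝓝 (v s))) ∧
    (∃ v : S → ℝ,
      (∀ s, IsMinimaxValue (totalCost Q c 1 s) (ENNReal.ofReal (v s))) ∧
      IsLeast {v' : S → ℝ | (∀ s, 0 ≤ v' s) ∧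
        ∀ s, v' s = targetShapley Q T (fun _ s' => c s') v' s} v ∧
      ∀ vn : ℕ → S → ℝ, (∀ s, 0 ≤ vn 0 s) → (∀ s ∈ T, vn 0 s = 0) →
        (∀ n s, vn (n + 1) s = targetShapley Q T (fun _ s' => c s') (vn n) s) →
        ∀ s, Tendsto (fun n => vn n s) atTop (𝓝 (v s))) := by
  have hc0 : ∀ s ∈ T, c s = 0 := fun s => (hcT s).2
  have hcT' : ∀ s, c s = 0 → s ∈ T := fun s => (hcT s).1
  obtain ⟨v, hlim⟩ := hQ.exists_tendsto_bellman_iterate hT hc hc0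
  have hcv := cost_le_of_tendsto_bellman_iterate hlim hc
  have hvalue := isMinimaxValue_totalCost_zero hc hlim
  refine ⟨⟨v, hvalue, isLeast_fixedPoints_targetShapley_current hT hc hc0 hlim, ?_⟩,
    v - c, fun s => (hvalue s).totalCost_one hc hcv,
    isLeast_fixedPoints_targetShapley_next hT hc hc0 hlim, ?_⟩
  · exact fun x hx0 hxT hx =>
      tendsto_pi_nhds.1 (tendsto_valueIteration_current hT hc hc0 hlim hcT' hx0 hxT hx)
  · exact fun x hx0 hxT hx =>
      tendsto_pi_nhds.1 (tendsto_valueIteration_next hT hc hc0 hlim hcT' hx0 hxT hx)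

/-- First part: the game whose payoff is the capture time `∑_{t ≥ 0} r(x_t, y_t)`; the stage payment
in the optimality equations is `r` at the current position. Second part: the game whose payoff is
`∑_{t ≥ 1} r(x_t, y_t)`; the stage payment is `r` at the next position. -/
theorem theorem4p6 {V : Type*} [Fintype V] (G : SimpleGraph V) (hG : G.Connected)
    (hc : concurrentCopNumber G = 1) :
    (∃ v : Position V V → ℝ,
      (∀ s, IsGameValue G 0 s (ENNReal.ofReal (v s))) ∧
      IsLeast {v' : Position V V → ℝ | (∀ s, 0 ≤ v' s) ∧
        ∀ s, v' s = shapley G (fun s _ => reward s) v' s} v ∧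
      ∀ vn : ℕ → Position V V → ℝ,
        (∀ s, 0 ≤ vn 0 s) → (∀ x, vn 0 ⟨x, x⟩ = 0) →
        (∀ n s, vn (n + 1) s = shapley G (fun s _ => reward s) (vn n) s) →
        ∀ s, Tendsto (fun n => vn n s) atTop (𝓝 (v s))) ∧
    (∃ v : Position V V → ℝ,
      (∀ s, IsGameValue G 1 s (ENNReal.ofReal (v s))) ∧
      IsLeast {v' : Position V V → ℝ | (∀ s, 0 ≤ v' s) ∧
        ∀ s, v' s = shapley G (fun _ s' => reward s') v' s} v ∧
      ∀ vn : ℕ → Position V V → ℝ,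
        (∀ s, 0 ≤ vn 0 s) → (∀ x, vn 0 ⟨x, x⟩ = 0) →
        (∀ n s, vn (n + 1) s = shapley G (fun _ s' => reward s') (vn n) s) →
        ∀ s, Tendsto (fun n => vn n s) atTop (𝓝 (v s))) := by
  have := hG.nonempty
  simpa only [forall_mem_captureSet] using! theorem4p6_general (inescapable_captureSet hc)
    isAbsorbing_nextPos reward_nonneg reward_eq_zero_iff
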